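/- For a real $n\times n$ matrix $A$ with singular values $\sigma_1,\dots,\sigma_n$ and $p\in[1,2]$ let $\|A\|_p=(\sum_i\sigma_i^p)^{1/p}$ be the Schatten-$p$ norm. The matrix $A$ is accessed only through matrix-vector multiplication queries: a query names a vector $v\in\mathbb R^n$ (possibly depending on earlier answers) and returns $Av$. For $k\ge 1$, the Hutch++ estimator with $k$ columns is the following randomized algorithm. Draw $S,G\in\{-1,1\}^{n\times k}$ with independent uniformly random sign entries; query $A$ on the columns of $S$ and compute an orthonormal basis $Q$ of the column span of $AS$; query $A$ on the columns of $Q$ and of $(I-QQ^{\mathsf T})G$; output $$\mathrm{Hutch}^{++}_k(A)=\operatorname{tr}(Q^{\mathsf T}AQ)+\frac1k\operatorname{tr}\bigl(G^{\mathsf T}(I-QQ^{\mathsf T})A(I-QQ^{\mathsf T})G\bigr).$$ **Theorem.** For every $\delta_0<1$ there is a constant $C>0$, depending only on $\delta_0$ (so $C$ is absolute once, say, $\delta_0=1/2$ is fixed), such that for all $p\in[1,2]$, $\varepsilon>0$ and $\delta\in(0,\delta_0]$ there is an integer $k\ge 1$, depending only on $p,\varepsilon,\delta,\delta_0$, with the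 following property. For every $n$ and every real $n\times n$ matrix $A$, the estimator $\mathrm{Hutch}^{++}_k$ always makes at most $$C\left(\left(\frac{\sqrt{\log(1/\delta)}}{\varepsilon}\right)^{p}+\log(1/\delta)\right)$$ matrix-vector multiplication queries to $A$, and with probability at least $1-\delta$ $$\bigl|\operatorname{tr}(A)-\mathrm{Hutch}^{++}_k(A)\bigr|\le\varepsilon\,\|A\|_p .$$ -/

import Mathlib

/-- Column vectors of length `n`, with the Euclidean inner product and norm. -/
abbrev Vec (n : ℕ) : Type := EuclideanSpace ℝ (Fin n)

/-- The matrix-vector product `A v`. -/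
noncomputable def matVec {n : ℕ} (A : Matrix (Fin n) (Fin n) ℝ) (v : Vec n) : Vec n :=
  WithLp.toLp 2 (A.mulVec v.ofLp)

/-- The Schatten-`p` norm `(∑ σᵢ ^ p) ^ (1 / p)`, where `σᵢ` are the `n` singular values of the
`n × n` matrix `A`. -/
noncomputable def schattenNorm {n : ℕ} (p : ℝ) (A : Matrix (Fin n) (Fin n) ℝ) : ℝ :=
  (∑ i ∈ Finset.range n, (Matrix.toEuclideanLin A).singularValues i ^ p) ^ (1 / p)

/-- Adaptive algorithms (in exact real arithmetic) that access an unknown `n × n` matrix `A` only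
through matrix-vector multiplication queries: such an algorithm either stops with an output, or
names a query vector `v`, is told `A v`, and continues depending on the answer. -/
inductive MatVecAlg (n : ℕ) (α : Type) : Type
  | output (a : α) : MatVecAlg n α
  | query (v : Vec n) (next : Vec n → MatVecAlg n α) : MatVecAlg n α

namespace MatVecAlg

/-- The output of the algorithm when the unknown matrix is `A`. -/
noncomputable def run {n : ℕ} {α : Type} (A : Matrix (Fin n) (Fin n) ℝ) : MatVecAlg n α → α
  | output a => a
  | query v next => run A (next (matVec A v))

/-- The number of queries the algorithm makes when the unknown matrix is `A`. -/
noncomputable def numQueries {n : ℕ} {α : Type} (A : Matrix (Fin n) (Fin n) ℝ) :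
    MatVecAlg n α → ℕ
  | output _ => 0
  | query v next => numQueries A (next (matVec A v)) + 1

/-- Sequential composition. -/
def andThen {n : ℕ} {α β : Type} : MatVecAlg n α → (α → MatVecAlg n β) → MatVecAlg n β
  | output a, f => f a
  | query v next, f => query v fun y => andThen (next y) f

/-- Query the vectors `v 0, …, v (k - 1)` one after the other and return all `k` answers. -/
def queryAll {n : ℕ} : {k : ℕ} → (Fin k → Vec n) → MatVecAlg n (Fin k → Vec n)
  | 0, _ => output fun i => i.elim0
  | _ + 1, v => query (v 0) fun y =>
      andThen (queryAll fun i => v i.succ) fun ys => output (Fin.cons y ys)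

end MatVecAlg

/-- The Hutch++ estimator with sketch matrices `S` and `G`, given by their `k` columns.
With `Q` an orthonormal basis of the column span of `A S`, its output is
`tr (Qᵀ A Q) + (1 / k) tr (Gᵀ (1 - Q Qᵀ) A (1 - Q Qᵀ) G)`.
The basis is computed by Gram-Schmidt, which returns a zero vector for each column that depends on
the earlier ones; these zero vectors contribute nothing to the sums below. -/
noncomputable def hutchPP {n k : ℕ} (S G : Fin k → Vec n) : MatVecAlg n ℝ :=
  (MatVecAlg.queryAll S).andThen fun AS =>
    let Q : Fin k → Vec n := InnerProductSpace.gramSchmidtNormed ℝ AS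
    (MatVecAlg.queryAll Q).andThen fun AQ =>
      let H : Fin k → Vec n := fun j => G j - ∑ i, inner ℝ (Q i) (G j) • Q i
      (MatVecAlg.queryAll H).andThen fun AH =>
        MatVecAlg.output
          (∑ i, inner ℝ (Q i) (AQ i) + (1 / (k : ℝ)) * ∑ j, inner ℝ (H j) (AH j))

/-- Matrices with `n` rows, `k` columns and entries `± 1`, as families of columns. -/
abbrev SignMatrix (n k : ℕ) : Type := Fin k → Fin n → ℤˣ

/-- The columns of a sign matrix as real vectors. -/
noncomputable def SignMatrix.col {n k : ℕ} (s : SignMatrix n k) (j : Fin k) : Vec n :=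
  WithLp.toLp 2 fun i => ((s j i : ℤ) : ℝ)

/-- The joint law of two `n × k` matrices whose entries are all independent Rademacher variables,
that is, the uniform distribution on pairs of sign matrices. -/
noncomputable def rademacherPair (n k : ℕ) : PMF (SignMatrix n k × SignMatrix n k) :=
  PMF.uniformOfFintype (SignMatrix n k × SignMatrix n k)

/-- The randomized Hutch++ estimator: the Hutch++ run determined by the outcome `ω` of the random
signs. -/
noncomputable def hutchPPRandom (n k : ℕ) (ω : SignMatrix n k × SignMatrix n k) : MatVecAlg n ℝ :=
  hutchPP ω.1.col ω.2.col

open Real Matrix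

/-! Put P = 1 - QQᵀ. Since tr A = tr(QᵀAQ) + tr(PAP) exactly, the error of Hutch++ is that of the
plain k-sample Rademacher trace estimator applied to PAP, with G independent of P. A Hanson–Wright
bound (`card_abs_traceDev_gt_le`) makes this error at most a constant times √(l/k) ‖PAP‖_F, except
with probability 2 exp(-l), when l is small compared with k.

It remains to bound ‖PAP‖_F (`exists_bad_sketch`). Let R project onto the top r right singular
vectors of A, and let k be a large constant times r. With high probability S is bounded below on the
range of R (the same tail bound on a net) and A(1 - R)S has at most twice its expected energy. As P
annihilates AS, this forces ‖PA‖_F² ≤ 5‖A(1 - R)‖_F² (`frobSq_mul_le_of_annihilates`). Monotonicity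
of the singular values gives ‖A(1 - R)‖_F ≤ r^(1/2 - 1/p) ‖A‖_p (`sum_sq_tail_le_rpow`).

Multiplying, the error is at most √l r^(-1/p) ‖A‖_p, so r ≈ l + (√l/ε)^p with l = log(6/δ) suffices.
-/

/-- The real vector of a family of signs. -/
noncomputable def signVec {n : ℕ} (s : Fin n → ℤˣ) : Fin n → ℝ := fun i => ((s i : ℤ) : ℝ)

/-! ### Frobenius norms and rank-one matrices -/

/-- The squared Frobenius norm of a real matrix. -/
noncomputable def frobSq {m n : ℕ} (B : Matrix (Fin m) (Fin n) ℝ) : ℝ := ∑ i, ∑ j, B i j ^ 2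

theorem frobSq_nonneg {m n : ℕ} (B : Matrix (Fin m) (Fin n) ℝ) : 0 ≤ frobSq B :=
  Finset.sum_nonneg fun _ _ => Finset.sum_nonneg fun _ _ => sq_nonneg _

theorem frobSq_transpose {m n : ℕ} (B : Matrix (Fin m) (Fin n) ℝ) : frobSq Bᵀ = frobSq B :=
  Finset.sum_comm

theorem frobSq_smul {m n : ℕ} (c : ℝ) (B : Matrix (Fin m) (Fin n) ℝ) :
    frobSq (c • B) = c ^ 2 * frobSq B := by
  simp [frobSq, Finset.mul_sum, mul_pow]

theorem frobSq_vecMulVec {m n : ℕ} (x : Fin m → ℝ) (y : Fin n → ℝ) :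
    frobSq (vecMulVec x y) = (x ⬝ᵥ x) * (y ⬝ᵥ y) := by
  simp only [frobSq, vecMulVec_apply, dotProduct, Finset.sum_mul_sum]
  exact Finset.sum_congr rfl fun _ _ => Finset.sum_congr rfl fun _ _ => by ring

theorem sq_dotProduct_mulVec_le {m n : ℕ} (B : Matrix (Fin m) (Fin n) ℝ) (x : Fin m → ℝ)
    (y : Fin n → ℝ) : (x ⬝ᵥ B *ᵥ y) ^ 2 ≤ frobSq B * ((x ⬝ᵥ x) * (y ⬝ᵥ y)) := by
  have h := Finset.sum_mul_sq_le_sq_mul_sq (Finset.univ : Finset (Fin m × Fin n))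
    (fun q => B q.1 q.2) (fun q => x q.1 * y q.2)
  have e1 : x ⬝ᵥ B *ᵥ y = ∑ q : Fin m × Fin n, B q.1 q.2 * (x q.1 * y q.2) := by
    simp only [Fintype.sum_prod_type, dotProduct, mulVec, Finset.mul_sum]
    exact Finset.sum_congr rfl fun _ _ => Finset.sum_congr rfl fun _ _ => by ring
  have e2 : frobSq B = ∑ q : Fin m × Fin n, B q.1 q.2 ^ 2 := by
    simp only [Fintype.sum_prod_type, frobSq]
  have e3 : (x ⬝ᵥ x) * (y ⬝ᵥ y) = ∑ q : Fin m × Fin n, (x q.1 * y q.2) ^ 2 := by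
    rw [← frobSq_vecMulVec]
    simp only [Fintype.sum_prod_type, frobSq, vecMulVec_apply]
  rw [e1, e2, e3]
  exact h

theorem frobSq_add_smul_vecMulVec {n : ℕ} (B : Matrix (Fin n) (Fin n) ℝ) (b : Fin n → ℝ) :
    frobSq (B + (2 : ℝ) • vecMulVec b b) =
      frobSq B + 4 * (b ⬝ᵥ B *ᵥ b) + 4 * (b ⬝ᵥ b) ^ 2 := by
  rw [sq, ← frobSq_vecMulVec]
  simp only [frobSq, dotProduct, mulVec, Finset.mul_sum, ← Finset.sum_add_distrib]
  refine Finset.sum_congr rfl fun _ _ => Finset.sum_congr rfl fun _ _ => ?_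
  simp [vecMulVec_apply]
  ring

theorem dotProduct_vecMulVec_mulVec {n : ℕ} (x a b y : Fin n → ℝ) :
    x ⬝ᵥ vecMulVec a b *ᵥ y = (x ⬝ᵥ a) * (b ⬝ᵥ y) := by
  rw [dotProduct_mulVec, vecMul_vecMulVec, smul_dotProduct, smul_eq_mul]

theorem dotProduct_self_real_nonneg {n : ℕ} (x : Fin n → ℝ) : 0 ≤ x ⬝ᵥ x :=
  Finset.sum_nonneg fun _ _ => mul_self_nonneg _

/-! ### Exponential moments of Rademacher quadratic forms -/

theorem sum_intUnits (f : ℤˣ → ℝ) : ∑ u, f u = f 1 + f (-1) := by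
  have : (Finset.univ : Finset ℤˣ) = {1, -1} := rfl
  rw [this, Finset.sum_pair (by decide)]

theorem exp_add_add_exp_sub_le (q c : ℝ) :
    exp (q + 2 * c) + exp (q - 2 * c) ≤ 2 * exp (q + 2 * c ^ 2) := by
  have h := cosh_le_exp_half_sq (2 * c)
  rw [cosh_eq] at h
  have e : exp (q + 2 * c) + exp (q - 2 * c) =
      2 * (exp q * ((exp (2 * c) + exp (-(2 * c))) / 2)) := by
    rw [exp_add, sub_eq_add_neg, exp_add]; ring
  rw [e, exp_add, show 2 * c ^ 2 = (2 * c) ^ 2 / 2 by ring]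
  gcongr

theorem signVec_cons {n : ℕ} (u : ℤˣ) (s : Fin n → ℤˣ) :
    signVec (Fin.cons u s : Fin (n + 1) → ℤˣ) = Fin.cons ((u : ℤ) : ℝ) (signVec s) := by
  funext i
  refine Fin.cases ?_ (fun j => ?_) i <;> simp [signVec]

theorem cons_dotProduct_mulVec_cons {n : ℕ} {B : Matrix (Fin (n + 1)) (Fin (n + 1)) ℝ}
    (hB : B.IsSymm) (e : ℝ) (x : Fin n → ℝ) :
    (Fin.cons e x : Fin (n + 1) → ℝ) ⬝ᵥ B *ᵥ (Fin.cons e x : Fin (n + 1) → ℝ) =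
      e ^ 2 * B 0 0 + 2 * (e * ((fun i => B 0 i.succ) ⬝ᵥ x)) +
        x ⬝ᵥ B.submatrix Fin.succ Fin.succ *ᵥ x := by
  simp only [dotProduct, mulVec, Fin.sum_univ_succ, Fin.cons_zero, Fin.cons_succ,
    submatrix_apply, mul_add, Finset.sum_add_distrib]
  have : ∀ i : Fin n, B i.succ 0 = B 0 i.succ := fun i => hB.apply _ _
  simp only [this]
  have h2 : ∑ i, x i * (B 0 i.succ * e) = e * ∑ i, B 0 i.succ * x i := by
    rw [Finset.mul_sum]; exact Finset.sum_congr rfl fun _ _ => by ring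
  rw [h2]
  ring

theorem frobSq_succ {n : ℕ} {B : Matrix (Fin (n + 1)) (Fin (n + 1)) ℝ} (hB : B.IsSymm) :
    frobSq B = B 0 0 ^ 2 + 2 * ((fun i : Fin n => B 0 i.succ) ⬝ᵥ fun i : Fin n => B 0 i.succ) +
      frobSq (B.submatrix Fin.succ Fin.succ) := by
  have : ∀ i : Fin n, B i.succ 0 = B 0 i.succ := fun i => hB.apply _ _
  simp only [frobSq, Fin.sum_univ_succ, this, Finset.sum_add_distrib, dotProduct,
    submatrix_apply, sq]
  ring

/-- The exponential moment of a symmetric quadratic form in Rademacher variables. -/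
theorem sum_exp_quadForm_signVec_le_of_isSymm {n : ℕ} (B : Matrix (Fin n) (Fin n) ℝ)
    (hB : B.IsSymm) (hF : frobSq B ≤ 1 / 16) :
    ∑ s : Fin n → ℤˣ, exp (signVec s ⬝ᵥ B *ᵥ signVec s) ≤
      2 ^ n * exp (B.trace + 4 * frobSq B) := by
  induction n with
  | zero => simp [frobSq, Matrix.trace]
  | succ n ih =>
    set b : Fin n → ℝ := fun i => B 0 i.succ with hb
    set B₀ := B.submatrix Fin.succ Fin.succ with hB₀
    -- Averaging over the first sign turns its cross term into cosh(2 b·t) ≤ exp(2 (b·t)²), which is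
    -- again a quadratic form in the remaining signs and is absorbed into `B₀`.
    set B₁ := B₀ + (2 : ℝ) • vecMulVec b b with hB₁
    have hfr : frobSq B = B 0 0 ^ 2 + 2 * (b ⬝ᵥ b) + frobSq B₀ := frobSq_succ hB
    have hbb : 0 ≤ b ⬝ᵥ b := dotProduct_self_real_nonneg b
    have h0 := frobSq_nonneg B₀
    have h00 := sq_nonneg (B 0 0)
    have hcs := sq_dotProduct_mulVec_le B₀ b b
    have hq : b ⬝ᵥ B₀ *ᵥ b ≤ (b ⬝ᵥ b) / 4 := by
      apply le_of_sq_le_sq _ (by positivity)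
      refine hcs.trans ?_
      have : frobSq B₀ ≤ 1 / 16 := by linarith
      nlinarith [mul_nonneg hbb hbb]
    have hfr₁ := frobSq_add_smul_vecMulVec B₀ b
    have hb32 : b ⬝ᵥ b ≤ 1 / 32 := by linarith
    have hsq : (b ⬝ᵥ b) ^ 2 ≤ (b ⬝ᵥ b) / 32 := by nlinarith
    -- The trace grows by 2|b|², paid for by the 8|b|² that 4 `frobSq B` loses with the first row
    -- and column. The terms 16 bᵀB₀b + 16|b|⁴ cost at most 4.5|b|², below the 6|b|² left.
    have hmain : 4 * frobSq B₁ + 2 * (b ⬝ᵥ b) ≤ 4 * frobSq B := by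
      rw [hB₁, hfr₁, hfr]; linarith
    have hsymm : B₁.IsSymm := by
      ext i j
      simp [hB₁, hB₀, vecMulVec_apply, hB.apply i.succ j.succ, mul_comm]
    have hih := ih B₁ hsymm (by linarith)
    have htr : B.trace = B 0 0 + B₀.trace := by simp [Matrix.trace, Fin.sum_univ_succ, hB₀]
    have htr₁ : B₁.trace = B₀.trace + 2 * (b ⬝ᵥ b) := by
      simp [hB₁, Matrix.trace_add, Matrix.trace_smul, trace_vecMulVec]
    calc ∑ s : Fin (n + 1) → ℤˣ, exp (signVec s ⬝ᵥ B *ᵥ signVec s)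
        = ∑ t : Fin n → ℤˣ, ∑ u : ℤˣ, exp (signVec (Fin.cons u t : Fin (n + 1) → ℤˣ) ⬝ᵥ
            B *ᵥ signVec (Fin.cons u t : Fin (n + 1) → ℤˣ)) := by
          rw [Finset.sum_comm, ← Fintype.sum_prod_type']
          exact (Fintype.sum_equiv (Fin.consEquiv fun _ => ℤˣ) _ _ fun _ => rfl).symm
      _ ≤ ∑ t : Fin n → ℤˣ, 2 * (exp (B 0 0) * exp (signVec t ⬝ᵥ B₁ *ᵥ signVec t)) := by
          refine Finset.sum_le_sum fun t _ => ?_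
          rw [sum_intUnits]
          simp only [signVec_cons, cons_dotProduct_mulVec_cons hB]
          have := exp_add_add_exp_sub_le (B 0 0 + signVec t ⬝ᵥ B₀ *ᵥ signVec t) (b ⬝ᵥ signVec t)
          refine le_trans (le_of_eq ?_) (this.trans (le_of_eq ?_))
          · congr 2 <;> push_cast <;> ring
          · rw [← exp_add, hB₁, add_mulVec, dotProduct_add, smul_mulVec, dotProduct_smul,
              dotProduct_vecMulVec_mulVec, dotProduct_comm (signVec t) b, smul_eq_mul]
            congr 2
            ring
      _ = 2 * exp (B 0 0) * ∑ t : Fin n → ℤˣ, exp (signVec t ⬝ᵥ B₁ *ᵥ signVec t) := by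
          rw [Finset.mul_sum]; exact Finset.sum_congr rfl fun _ _ => by ring
      _ ≤ 2 * exp (B 0 0) * (2 ^ n * exp (B₁.trace + 4 * frobSq B₁)) := by gcongr
      _ = 2 ^ (n + 1) * exp (B 0 0 + (B₁.trace + 4 * frobSq B₁)) := by rw [exp_add (B 0 0)]; ring
      _ ≤ 2 ^ (n + 1) * exp (B.trace + 4 * frobSq B) := by
          have : B 0 0 + (B₁.trace + 4 * frobSq B₁) ≤ B.trace + 4 * frobSq B := by
            rw [htr, htr₁]; linarith
          gcongr

/-- Symmetrizing `B` keeps the quadratic form and the trace and does not increase the Frobenius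
norm. -/
theorem sum_exp_quadForm_signVec_le {n : ℕ} (B : Matrix (Fin n) (Fin n) ℝ)
    (hF : frobSq B ≤ 1 / 16) :
    ∑ s : Fin n → ℤˣ, exp (signVec s ⬝ᵥ B *ᵥ signVec s) ≤
      2 ^ n * exp (B.trace + 4 * frobSq B) := by
  set M := (1 / 2 : ℝ) • (B + Bᵀ) with hM
  have hfr : frobSq M ≤ frobSq B := by
    have h2 : frobSq B = ∑ i, ∑ j, (B i j ^ 2 + B j i ^ 2) / 2 := by
      simp only [← Finset.sum_div, Finset.sum_add_distrib]
      have : ∑ i, ∑ j, B j i ^ 2 = frobSq B := frobSq_transpose B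
      rw [this]
      simp [frobSq]
    rw [h2]
    refine Finset.sum_le_sum fun i _ => Finset.sum_le_sum fun j _ => ?_
    simp only [hM, Matrix.smul_apply, Matrix.add_apply, transpose_apply, smul_eq_mul]
    nlinarith [sq_nonneg (B i j - B j i)]
  have htr : M.trace = B.trace := by
    rw [hM, trace_smul, trace_add, trace_transpose, smul_eq_mul]; ring
  have hq : ∀ x : Fin n → ℝ, x ⬝ᵥ M *ᵥ x = x ⬝ᵥ B *ᵥ x := fun x => by
    have : x ⬝ᵥ Bᵀ *ᵥ x = x ⬝ᵥ B *ᵥ x := by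
      rw [mulVec_transpose, dotProduct_comm, ← dotProduct_mulVec]
    rw [hM, smul_mulVec, add_mulVec, dotProduct_smul, dotProduct_add, this, smul_eq_mul]; ring
  have h := sum_exp_quadForm_signVec_le_of_isSymm M
    (by ext i j; simp [hM, add_comm]) (hfr.trans hF)
  simp only [hq, htr] at h
  refine h.trans ?_
  gcongr

/-! ### Tail bound for the Rademacher trace estimator -/

/-- The deviation of the Rademacher trace estimator with `k` samples, times `k`. -/
noncomputable def traceDev {n k : ℕ} (B : Matrix (Fin n) (Fin n) ℝ) (s : SignMatrix n k) : ℝ :=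
  ∑ j, (signVec (s j) ⬝ᵥ B *ᵥ signVec (s j) - B.trace)

theorem traceDev_neg {n k : ℕ} (B : Matrix (Fin n) (Fin n) ℝ) (s : SignMatrix n k) :
    traceDev (-B) s = -traceDev B s := by
  simp only [traceDev, neg_mulVec, dotProduct_neg, trace_neg, ← Finset.sum_neg_distrib]
  exact Finset.sum_congr rfl fun _ _ => by ring

theorem traceDev_smul {n k : ℕ} (c : ℝ) (B : Matrix (Fin n) (Fin n) ℝ) (s : SignMatrix n k) :
    traceDev (c • B) s = c * traceDev B s := by
  simp only [traceDev, smul_mulVec, dotProduct_smul, trace_smul, Finset.mul_sum, smul_eq_mul,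
    mul_sub]

theorem card_signMatrix (n k : ℕ) : (Fintype.card (SignMatrix n k) : ℝ) = (2 ^ n) ^ k := by
  simp

theorem sum_exp_traceDev_le {n : ℕ} (k : ℕ) (B : Matrix (Fin n) (Fin n) ℝ)
    (hF : frobSq B ≤ 1 / 16) :
    ∑ s : SignMatrix n k, exp (traceDev B s) ≤
      Fintype.card (SignMatrix n k) * exp (k * (4 * frobSq B)) := by
  have e : ∑ s : SignMatrix n k, exp (traceDev B s) =
      (∑ s : Fin n → ℤˣ, exp (signVec s ⬝ᵥ B *ᵥ signVec s - B.trace)) ^ k := by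
    rw [Fintype.sum_pow]
    exact Finset.sum_congr rfl fun s _ => by rw [traceDev, exp_sum]
  have h : ∑ s : Fin n → ℤˣ, exp (signVec s ⬝ᵥ B *ᵥ signVec s - B.trace) ≤
      2 ^ n * exp (4 * frobSq B) := by
    simp only [exp_sub, ← Finset.sum_div]
    rw [div_le_iff₀ (exp_pos _), mul_assoc, ← exp_add, add_comm (4 * _)]
    exact sum_exp_quadForm_signVec_le B hF
  rw [e, card_signMatrix, exp_nat_mul, ← mul_pow]
  exact pow_le_pow_left₀ (Finset.sum_nonneg fun _ _ => (exp_pos _).le) h k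

/-- Markov's inequality for the exponential moment of (a/F)B. The parameter `a` stays free; a = τ/8
maximizes the exponent. -/
theorem card_traceDev_gt_le {n : ℕ} (k : ℕ) (B : Matrix (Fin n) (Fin n) ℝ) {F a τ : ℝ}
    (hF : 0 < F) (hB : frobSq B ≤ F ^ 2) (ha : 0 ≤ a) (ha4 : a ≤ 1 / 4) :
    ((Finset.univ.filter fun s : SignMatrix n k => k * (τ * F) < traceDev B s).card : ℝ) ≤
      exp (-(k * (a * τ - 4 * a ^ 2))) * Fintype.card (SignMatrix n k) := by
  have hfr : frobSq ((a / F) • B) ≤ a ^ 2 := by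
    rw [frobSq_smul, div_pow, div_mul_eq_mul_div, div_le_iff₀ (by positivity)]
    gcongr
  have h := sum_exp_traceDev_le k ((a / F) • B) (hfr.trans (by nlinarith))
  have h1 : ((Finset.univ.filter fun s : SignMatrix n k =>
      k * (τ * F) < traceDev B s).card : ℝ) * exp (k * (a * τ)) ≤
      ∑ s : SignMatrix n k, exp (traceDev ((a / F) • B) s) := by
    rw [← nsmul_eq_mul, ← Finset.sum_const]
    refine (Finset.sum_le_sum fun s hs => ?_).trans
      (Finset.sum_le_sum_of_subset_of_nonneg (Finset.filter_subset _ _)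
        fun _ _ _ => (exp_pos _).le)
    rw [exp_le_exp, traceDev_smul]
    have hs' := (Finset.mem_filter.mp hs).2
    calc k * (a * τ) = a / F * (k * (τ * F)) := by field_simp
      _ ≤ _ := by gcongr
  have h2 : exp (k * (4 * frobSq ((a / F) • B))) ≤ exp (k * (4 * a ^ 2)) := by gcongr
  rw [show -(k * (a * τ - 4 * a ^ 2)) = k * (4 * a ^ 2) - k * (a * τ) by ring, exp_sub,
    div_mul_eq_mul_div, le_div_iff₀ (exp_pos _), mul_comm (exp _)]
  exact h1.trans (h.trans (by gcongr))

/-- A Hanson–Wright tail bound for the Rademacher trace estimator. -/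
theorem card_abs_traceDev_gt_le {n : ℕ} (k : ℕ) (B : Matrix (Fin n) (Fin n) ℝ) {F a τ : ℝ}
    (hF : 0 ≤ F) (hB : frobSq B ≤ F ^ 2) (ha : 0 ≤ a) (ha4 : a ≤ 1 / 4) :
    ((Finset.univ.filter fun s : SignMatrix n k => k * (τ * F) < |traceDev B s|).card : ℝ) ≤
      2 * exp (-(k * (a * τ - 4 * a ^ 2))) * Fintype.card (SignMatrix n k) := by
  classical
  -- The rescaling by a/F needs F > 0; for F = 0 the matrix vanishes and the strict inequality never
  -- holds.
  rcases hF.eq_or_lt with rfl | hF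
  · have hz : B = 0 := by
      ext i j
      have h0 : frobSq B = 0 := le_antisymm (by simpa using hB) (frobSq_nonneg B)
      have h1 := (Finset.sum_eq_zero_iff_of_nonneg fun i _ =>
        Finset.sum_nonneg fun j _ => sq_nonneg (B i j)).mp h0 i (Finset.mem_univ _)
      have h2 := (Finset.sum_eq_zero_iff_of_nonneg fun j _ => sq_nonneg (B i j)).mp h1 j
        (Finset.mem_univ _)
      simpa using h2
    have : ∀ s : SignMatrix n k, traceDev B s = 0 := fun s => by simp [traceDev, hz]
    simp only [this]
    simp
    positivity
  · have h1 := card_traceDev_gt_le (τ := τ) k B hF hB ha ha4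
    have h2 := card_traceDev_gt_le (τ := τ) k (-B) hF
      (by simpa [frobSq] using hB) ha ha4
    have h3 : (Finset.univ.filter fun s : SignMatrix n k => k * (τ * F) < |traceDev B s|) ⊆
        (Finset.univ.filter fun s : SignMatrix n k => k * (τ * F) < traceDev B s) ∪
        (Finset.univ.filter fun s : SignMatrix n k => k * (τ * F) < traceDev (-B) s) := by
      intro s hs
      simpa [traceDev_neg, lt_abs] using hs
    have h4 := (Finset.card_le_card h3).trans (Finset.card_union_le _ _)
    have h5 : ((Finset.univ.filter fun s : SignMatrix n k =>
        k * (τ * F) < |traceDev B s|).card : ℝ) ≤ _ := Nat.cast_le.mpr h4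
    push_cast at h5
    linarith

/-! ### Nets and lower bounds on a subspace -/

/-- A half-net of the unit ball of a `d`-dimensional real normed space with at most `5 ^ d`
points. -/
theorem exists_finset_half_net (E : Type*) [NormedAddCommGroup E] [NormedSpace ℝ E]
    [FiniteDimensional ℝ E] :
    ∃ N : Finset E, N.card ≤ 5 ^ Module.finrank ℝ E ∧ (∀ y ∈ N, ‖y‖ ≤ 1) ∧
      ∀ x : E, ‖x‖ ≤ 1 → ∃ y ∈ N, ‖x - y‖ ≤ 1 / 2 := by
  classical
  have hcard : ∀ N : Finset E, (∀ y ∈ N, ‖y‖ ≤ 1) →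
      (∀ y ∈ N, ∀ z ∈ N, y ≠ z → 1 / 2 ≤ ‖y - z‖) → N.card ≤ 5 ^ Module.finrank ℝ E := by
    intro N h1 h2
    -- Doubling gives a 1-separated set in the ball of radius 2, the normalization of
    -- `Besicovitch.card_le_of_separated`.
    have hinj : Function.Injective fun y : E => (2 : ℝ) • y := smul_right_injective E two_ne_zero
    rw [← Finset.card_image_of_injective N hinj]
    refine Besicovitch.card_le_of_separated _ ?_ ?_
    · intro c hc
      obtain ⟨y, hy, rfl⟩ := Finset.mem_image.mp hc
      rw [norm_smul, Real.norm_two]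
      linarith [h1 y hy]
    · intro c hc d hd hcd
      obtain ⟨y, hy, rfl⟩ := Finset.mem_image.mp hc
      obtain ⟨z, hz, rfl⟩ := Finset.mem_image.mp hd
      rw [← smul_sub, norm_smul, Real.norm_two]
      have := h2 y hy z hz (fun h => hcd (by rw [h]))
      linarith
  -- If no small set were a net, separated sets could be enlarged point by point beyond the bound
  -- `hcard`.
  by_contra! hcon
  have hall : ∀ m : ℕ, ∃ N : Finset E, N.card = m ∧ (∀ y ∈ N, ‖y‖ ≤ 1) ∧
      ∀ y ∈ N, ∀ z ∈ N, y ≠ z → 1 / 2 ≤ ‖y - z‖ := by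
    intro m
    induction m with
    | zero => exact ⟨∅, by simp⟩
    | succ m ih =>
      obtain ⟨N, hN, h1, h2⟩ := ih
      obtain ⟨x, hx, hxN⟩ := hcon N (hcard N h1 h2) h1
      have hxmem : x ∉ N := fun h => by
        have := hxN x h
        simp at this
        linarith
      refine ⟨insert x N, by rw [Finset.card_insert_of_notMem hxmem, hN], ?_, ?_⟩
      · intro y hy
        rcases Finset.mem_insert.mp hy with rfl | hy
        · exact hx
        · exact h1 y hy
      · intro y hy z hz hyz
        rcases Finset.mem_insert.mp hy with hy | hy <;>
          rcases Finset.mem_insert.mp hz with hz | hz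
        · exact absurd (hy.trans hz.symm) hyz
        · rw [hy]; exact (hxN z hz).le
        · rw [hz, norm_sub_rev]; exact (hxN y hy).le
        · exact h2 y hy z hz hyz
  obtain ⟨N, hN, h1, h2⟩ := hall (5 ^ Module.finrank ℝ E + 1)
  have := hcard N h1 h2
  omega

/-- Approximating a unit vector by a net point gives ‖L‖ ≤ c + ‖L‖/2. -/
theorem opNorm_le_two_mul_of_half_net {E F : Type*} [NormedAddCommGroup E] [NormedSpace ℝ E]
    [NormedAddCommGroup F] [NormedSpace ℝ F] {N : Finset E}
    (hN : ∀ x : E, ‖x‖ ≤ 1 → ∃ y ∈ N, ‖x - y‖ ≤ 1 / 2) (L : E →L[ℝ] F) {c : ℝ}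
    (hL : ∀ y ∈ N, ‖L y‖ ≤ c) : ‖L‖ ≤ 2 * c := by
  have h0 : 0 ≤ c := by
    obtain ⟨y, hy, -⟩ := hN 0 (by simp)
    exact (norm_nonneg _).trans (hL y hy)
  have h : ‖L‖ ≤ c + ‖L‖ * (1 / 2) := by
    refine L.opNorm_le_of_unit_norm (by positivity) fun x hx => ?_
    obtain ⟨y, hy, hxy⟩ := hN x hx.le
    calc ‖L x‖ = ‖L y + L (x - y)‖ := by rw [← map_add, add_sub_cancel]
      _ ≤ ‖L y‖ + ‖L (x - y)‖ := norm_add_le _ _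
      _ ≤ c + ‖L‖ * (1 / 2) := add_le_add (hL y hy) ((L.le_opNorm _).trans (by gcongr))
  linarith

/-- The bilinear form is a map from E to its dual, so the net argument is used once per variable;
each use costs a factor 2. -/
theorem abs_sum_sq_sub_le_of_half_net {E : Type*} [NormedAddCommGroup E] [InnerProductSpace ℝ E]
    {N : Finset E} (hN : ∀ x : E, ‖x‖ ≤ 1 → ∃ y ∈ N, ‖x - y‖ ≤ 1 / 2) {ι : Type*} [Fintype ι]
    (L : ι → E →L[ℝ] ℝ) (k : ℝ) {c : ℝ}
    (hL : ∀ y ∈ N, ∀ z ∈ N, |∑ j, L j y * L j z - k * inner ℝ y z| ≤ c) (x : E) :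
    |∑ j, L j x ^ 2 - k * ‖x‖ ^ 2| ≤ 4 * c * ‖x‖ ^ 2 := by
  let I : E →L[ℝ] E →L[ℝ] ℝ := innerSL ℝ
  let T : E →L[ℝ] E →L[ℝ] ℝ := ∑ j, (L j).smulRight (L j) - k • I
  have hI : ∀ y z : E, I y z = inner ℝ y z := fun y z => rfl
  have hT : ∀ y z : E, T y z = ∑ j, L j y * L j z - k * inner ℝ y z := by
    intro y z
    simp [T, hI]
  have hT1 : ‖T‖ ≤ 2 * (2 * c) :=
    opNorm_le_two_mul_of_half_net hN T fun y hy =>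
      opNorm_le_two_mul_of_half_net hN (T y) fun z hz => by
        rw [hT]; exact hL y hy z hz
  have h := T.le_opNorm₂ x x
  rw [hT, Real.norm_eq_abs, real_inner_self_eq_norm_sq] at h
  simp only [← sq, mul_assoc] at h
  refine h.trans ?_
  rw [show 4 * c * ‖x‖ ^ 2 = 2 * (2 * c) * ‖x‖ ^ 2 by ring]
  gcongr

theorem inner_col {n k : ℕ} (s : SignMatrix n k) (j : Fin k) (x : Vec n) :
    inner ℝ (s.col j) x = signVec (s j) ⬝ᵥ x.ofLp := by
  rw [EuclideanSpace.inner_eq_star_dotProduct, dotProduct_comm]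
  rfl

/-- This makes the trace tail bound, applied to y zᵀ, control the bilinear form of S at a pair of
net points. -/
theorem traceDev_vecMulVec {n k : ℕ} (y z : Vec n) (s : SignMatrix n k) :
    traceDev (vecMulVec y.ofLp z.ofLp) s =
      ∑ j, inner ℝ (s.col j) y * inner ℝ (s.col j) z - k * inner ℝ y z := by
  simp only [traceDev, dotProduct_vecMulVec_mulVec, inner_col, Finset.sum_sub_distrib,
    trace_vecMulVec, Finset.sum_const, Finset.card_univ, Fintype.card_fin, nsmul_eq_mul]
  congr 1
  · exact Finset.sum_congr rfl fun j _ => by rw [dotProduct_comm z.ofLp]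
  · rw [EuclideanSpace.inner_eq_star_dotProduct, dotProduct_comm]
    rfl

theorem ofLp_dotProduct_self {n : ℕ} (x : Vec n) : x.ofLp ⬝ᵥ x.ofLp = ‖x‖ ^ 2 := by
  rw [EuclideanSpace.real_norm_sq_eq]
  simp [dotProduct, sq]

theorem le_sum_sq_inner_col_of_half_net {n k : ℕ} {W : Submodule ℝ (Vec n)} {N : Finset W}
    (hN : ∀ x : W, ‖x‖ ≤ 1 → ∃ y ∈ N, ‖x - y‖ ≤ 1 / 2) {s : SignMatrix n k}
    (hs : ∀ y ∈ N, ∀ z ∈ N,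
      |traceDev (vecMulVec (y : Vec n).ofLp (z : Vec n).ofLp) s| ≤ k * (1 / 8))
    {x : Vec n} (hx : x ∈ W) : k / 2 * ‖x‖ ^ 2 ≤ ∑ j, inner ℝ (s.col j) x ^ 2 := by
  have h := abs_sum_sq_sub_le_of_half_net hN
    (fun j => (innerSL ℝ (s.col j)).comp W.subtypeL) k (c := k * (1 / 8))
    (fun y hy z hz => by
      have := hs y hy z hz
      rw [traceDev_vecMulVec] at this
      exact this) ⟨x, hx⟩
  have h2 := (abs_le.mp h).1
  change _ ≤ ∑ j, inner ℝ (s.col j) x ^ 2 - k * ‖x‖ ^ 2 at h2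
  rw [Submodule.coe_norm] at h2
  linarith

/-- A sign matrix with many columns is bounded below on a fixed low-dimensional subspace. -/
theorem card_not_le_sum_sq_inner_col_le {n : ℕ} (k : ℕ) {r : ℕ} (W : Submodule ℝ (Vec n))
    (hW : Module.finrank ℝ W ≤ r) :
    ∃ bad : Finset (SignMatrix n k),
      (bad.card : ℝ) ≤ 25 ^ r * (2 * exp (-(k / 1024))) * Fintype.card (SignMatrix n k) ∧
      ∀ s ∉ bad, ∀ x ∈ W, k / 2 * ‖x‖ ^ 2 ≤ ∑ j, inner ℝ (s.col j) x ^ 2 := by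
  classical
  obtain ⟨N, hNc, hN1, hN⟩ := exists_finset_half_net W
  refine ⟨(N ×ˢ N).biUnion fun q => Finset.univ.filter fun s : SignMatrix n k =>
    k * (1 / 8 * 1) < |traceDev (vecMulVec (q.1 : Vec n).ofLp (q.2 : Vec n).ofLp) s|, ?_, ?_⟩
  · refine (Nat.cast_le.mpr Finset.card_biUnion_le).trans ?_
    rw [Nat.cast_sum]
    have hq : ∀ q ∈ N ×ˢ N, ((Finset.univ.filter fun s : SignMatrix n k =>
        k * (1 / 8 * 1) < |traceDev (vecMulVec (q.1 : Vec n).ofLp (q.2 : Vec n).ofLp) s|).card : ℝ)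
        ≤ 2 * exp (-(k / 1024)) * Fintype.card (SignMatrix n k) := by
      intro q hq
      obtain ⟨hq1, hq2⟩ := Finset.mem_product.mp hq
      have hf : frobSq (vecMulVec (q.1 : Vec n).ofLp (q.2 : Vec n).ofLp) ≤ (1 : ℝ) ^ 2 := by
        rw [frobSq_vecMulVec, ofLp_dotProduct_self, ofLp_dotProduct_self, ← mul_pow]
        have h1 := hN1 _ hq1
        have h2 := hN1 _ hq2
        rw [Submodule.coe_norm] at h1 h2
        exact pow_le_pow_left₀ (by positivity) (mul_le_one₀ h1 (norm_nonneg _) h2) 2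
      -- Deviation k/8 on the net becomes k/2 on the subspace; a = τ/8 gives the exponent k/1024.
      have := card_abs_traceDev_gt_le (a := 1 / 64) (τ := 1 / 8) k _ zero_le_one hf
        (by norm_num) (by norm_num)
      convert this using 5
      norm_num [div_eq_mul_inv]
    refine (Finset.sum_le_sum hq).trans ?_
    rw [Finset.sum_const, nsmul_eq_mul, Finset.card_product, mul_assoc (25 ^ r)]
    gcongr
    have h5 : N.card ≤ 5 ^ r := hNc.trans (Nat.pow_le_pow_right (by norm_num) hW)
    calc ((N.card * N.card : ℕ) : ℝ) ≤ ((5 ^ r * 5 ^ r : ℕ) : ℝ) := by gcongr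
      _ = 25 ^ r := by push_cast; rw [← mul_pow]; norm_num
  · intro s hs x hx
    refine le_sum_sq_inner_col_of_half_net hN (fun y hy z hz => ?_) hx
    by_contra! h
    refine hs (Finset.mem_biUnion.mpr ⟨(y, z), Finset.mem_product.mpr ⟨hy, hz⟩, ?_⟩)
    simpa using h

/-! ### Orthogonal projections and the sketching inequality -/

theorem frobSq_eq_sum_row {m n : ℕ} (B : Matrix (Fin m) (Fin n) ℝ) :
    frobSq B = ∑ i, B i ⬝ᵥ B i := by
  simp [frobSq, dotProduct, sq]

theorem frobSq_eq_trace {m n : ℕ} (B : Matrix (Fin m) (Fin n) ℝ) :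
    frobSq B = (B * Bᵀ).trace := by
  simp [frobSq, Matrix.trace, mul_apply, sq]

theorem frobSq_transpose_mul_self_le {m n : ℕ} (M : Matrix (Fin m) (Fin n) ℝ) :
    frobSq (Mᵀ * M) ≤ frobSq M ^ 2 := by
  rw [← frobSq_transpose M, sq, frobSq_eq_sum_row Mᵀ, Finset.sum_mul_sum]
  refine Finset.sum_le_sum fun i _ => Finset.sum_le_sum fun j _ => ?_
  have := Finset.sum_mul_sq_le_sq_mul_sq Finset.univ (Mᵀ i) (Mᵀ j)
  simpa [mul_apply, dotProduct, sq] using this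

theorem dotProduct_mulVec_self_add {n : ℕ} {P : Matrix (Fin n) (Fin n) ℝ} (hs : P.IsSymm)
    (hi : P * P = P) (x : Fin n → ℝ) :
    x ⬝ᵥ x = P *ᵥ x ⬝ᵥ P *ᵥ x + (1 - P) *ᵥ x ⬝ᵥ (1 - P) *ᵥ x := by
  have h1 : P *ᵥ x ⬝ᵥ P *ᵥ x = x ⬝ᵥ P *ᵥ x := by
    rw [dotProduct_mulVec, ← mulVec_transpose, hs.eq, mulVec_mulVec, hi, dotProduct_comm]
  simp only [sub_mulVec, one_mulVec, dotProduct_sub, sub_dotProduct, h1,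
    dotProduct_comm (P *ᵥ x) x]
  ring

theorem dotProduct_mulVec_self_le {n : ℕ} {P : Matrix (Fin n) (Fin n) ℝ} (hs : P.IsSymm)
    (hi : P * P = P) (x : Fin n → ℝ) : P *ᵥ x ⬝ᵥ P *ᵥ x ≤ x ⬝ᵥ x := by
  rw [dotProduct_mulVec_self_add hs hi x]
  linarith [dotProduct_self_real_nonneg ((1 - P) *ᵥ x)]

theorem frobSq_mul_right_le {m n : ℕ} {P : Matrix (Fin n) (Fin n) ℝ} (hs : P.IsSymm)
    (hi : P * P = P) (B : Matrix (Fin m) (Fin n) ℝ) : frobSq (B * P) ≤ frobSq B := by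
  rw [frobSq_eq_sum_row, frobSq_eq_sum_row]
  refine Finset.sum_le_sum fun i _ => ?_
  have : (B * P) i = P *ᵥ B i := by
    rw [mul_apply_eq_vecMul, ← mulVec_transpose, hs.eq]
  rw [this]
  exact dotProduct_mulVec_self_le hs hi _

theorem frobSq_mul_left_le {m n : ℕ} {P : Matrix (Fin n) (Fin n) ℝ} (hs : P.IsSymm)
    (hi : P * P = P) (B : Matrix (Fin n) (Fin m) ℝ) : frobSq (P * B) ≤ frobSq B := by
  rw [← frobSq_transpose, ← frobSq_transpose B, transpose_mul, hs.eq]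
  exact frobSq_mul_right_le hs hi _

/-- If the range of `A S` is annihilated by the orthogonal projection `P` and `S` is bounded below
on the range of the orthogonal projection `R`, then `P A` is controlled by `A (1 - R)`. -/
theorem frobSq_mul_le_of_annihilates {n k : ℕ} {P A R : Matrix (Fin n) (Fin n) ℝ}
    (hP : P.IsSymm) (hPi : P * P = P) (hR : R.IsSymm) (hRi : R * R = R) (s : Fin k → Fin n → ℝ)
    (hs : ∀ j, P *ᵥ (A *ᵥ s j) = 0) {c : ℝ} (hc : 0 < c)
    (hlow : ∀ x, c * (R *ᵥ x ⬝ᵥ R *ᵥ x) ≤ ∑ j, (s j ⬝ᵥ R *ᵥ x) ^ 2) :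
    c * frobSq (P * A) ≤ c * frobSq (A * (1 - R)) +
      ∑ j, (A * (1 - R)) *ᵥ s j ⬝ᵥ (A * (1 - R)) *ᵥ s j := by
  have hrow : ∀ i, (P * (A * (1 - R))) i = (1 - R) *ᵥ (P * A) i := fun i => by
    rw [← Matrix.mul_assoc, mul_apply_eq_vecMul, ← mulVec_transpose, transpose_sub, hR.eq,
      transpose_one]
  have hzero : ∀ i j, s j ⬝ᵥ (P * A) i = 0 := fun i j => by
    have := congrFun (hs j) i
    rw [mulVec_mulVec] at this
    rw [dotProduct_comm]
    exact this
  -- Each row of PA is orthogonal to every `s j`, so its R-part and its (1 - R)-part have opposite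
  -- inner products with `s j`. The lower bound on the range of R thus bounds the R-part by the
  -- sketch of A(1 - R).
  have hsplit : ∀ i j, s j ⬝ᵥ R *ᵥ (P * A) i = -(P *ᵥ ((A * (1 - R)) *ᵥ s j)) i := fun i j => by
    have h1 : (P *ᵥ ((A * (1 - R)) *ᵥ s j)) i = s j ⬝ᵥ (1 - R) *ᵥ (P * A) i := by
      rw [mulVec_mulVec, ← hrow, dotProduct_comm]
      rfl
    rw [h1, sub_mulVec, one_mulVec, dotProduct_sub, hzero]
    ring
  calc c * frobSq (P * A)
      = ∑ i, (c * (R *ᵥ (P * A) i ⬝ᵥ R *ᵥ (P * A) i) +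
          c * ((P * (A * (1 - R))) i ⬝ᵥ (P * (A * (1 - R))) i)) := by
        rw [frobSq_eq_sum_row, Finset.mul_sum]
        refine Finset.sum_congr rfl fun i _ => ?_
        rw [dotProduct_mulVec_self_add hR hRi, hrow]
        ring
    _ ≤ ∑ i, (∑ j, (P *ᵥ ((A * (1 - R)) *ᵥ s j)) i ^ 2 +
          c * ((P * (A * (1 - R))) i ⬝ᵥ (P * (A * (1 - R))) i)) := by
        refine Finset.sum_le_sum fun i _ => ?_
        have := hlow ((P * A) i)
        simp only [hsplit, neg_sq] at this
        linarith
    _ = ∑ j, P *ᵥ ((A * (1 - R)) *ᵥ s j) ⬝ᵥ P *ᵥ ((A * (1 - R)) *ᵥ s j) +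
          c * frobSq (P * (A * (1 - R))) := by
        rw [Finset.sum_add_distrib, Finset.sum_comm, frobSq_eq_sum_row, Finset.mul_sum]
        simp [dotProduct, sq]
    _ ≤ _ := by
        rw [add_comm]
        refine add_le_add ?_ (Finset.sum_le_sum fun j _ => dotProduct_mulVec_self_le hP hPi _)
        gcongr
        exact frobSq_mul_left_le hP hPi _

/-- The energy of a matrix on the columns of a sign matrix concentrates around its mean. -/
theorem card_two_mul_frobSq_lt_sum_le {n : ℕ} (k : ℕ) (M : Matrix (Fin n) (Fin n) ℝ) :
    ((Finset.univ.filter fun s : SignMatrix n k =>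
      2 * k * frobSq M < ∑ j, M *ᵥ signVec (s j) ⬝ᵥ M *ᵥ signVec (s j)).card : ℝ) ≤
      2 * exp (-(k / 16)) * Fintype.card (SignMatrix n k) := by
  -- Here ‖MᵀM‖_F ≤ ‖M‖_F² = tr(MᵀM), so τ = 1 allows a deviation equal to the mean.
  have h := card_abs_traceDev_gt_le (a := 1 / 8) (τ := 1) k (Mᵀ * M) (frobSq_nonneg M)
    (frobSq_transpose_mul_self_le M) (by norm_num) (by norm_num)
  have e : (k : ℝ) * (1 / 8 * 1 - 4 * (1 / 8) ^ 2) = k / 16 := by ring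
  rw [e] at h
  refine le_trans ?_ h
  refine Nat.cast_le.mpr (Finset.card_le_card fun s hs => ?_)
  have hs' := (Finset.mem_filter.mp hs).2
  refine Finset.mem_filter.mpr ⟨Finset.mem_univ _, lt_of_lt_of_le ?_ (le_abs_self _)⟩
  have htr : (Mᵀ * M).trace = frobSq M := by rw [trace_mul_comm, frobSq_eq_trace]
  have hq : ∀ x, x ⬝ᵥ (Mᵀ * M) *ᵥ x = M *ᵥ x ⬝ᵥ M *ᵥ x := fun x => by
    rw [← mulVec_mulVec, dotProduct_mulVec, vecMul_transpose]
  simp only [traceDev, htr, hq, Finset.sum_sub_distrib, Finset.sum_const, Finset.card_univ,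
    Fintype.card_fin, nsmul_eq_mul]
  linarith

/-! ### The projection off the Gram–Schmidt basis -/

section Projection

variable {n k : ℕ}

/-- The matrix `1 - Q Qᵀ`, where `Q` has columns `q`. -/
noncomputable def projCompl (q : Fin k → Vec n) : Matrix (Fin n) (Fin n) ℝ :=
  1 - ∑ i, vecMulVec (q i).ofLp (q i).ofLp

theorem projCompl_isSymm (q : Fin k → Vec n) : (projCompl q).IsSymm := by
  simp [Matrix.IsSymm, projCompl, transpose_sub, transpose_sum, transpose_vecMulVec]

theorem toLp_projCompl_mulVec (q : Fin k → Vec n) (x : Vec n) :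
    WithLp.toLp 2 (projCompl q *ᵥ x.ofLp) = x - ∑ i, inner ℝ (q i) x • q i := by
  have h : ∀ i, inner ℝ (q i) x = (q i).ofLp ⬝ᵥ x.ofLp := fun i => by
    rw [EuclideanSpace.inner_eq_star_dotProduct, dotProduct_comm]; rfl
  apply WithLp.ofLp_injective 2
  simp [projCompl, sub_mulVec, sum_mulVec, vecMulVec_mulVec, h]

/-- Norm 0 is allowed because Gram–Schmidt returns zero vectors for dependent columns; either way ‖q
j‖² q j = q j. -/
theorem projCompl_mulVec_self {q : Fin k → Vec n} (hq : ∀ i j, i ≠ j → inner ℝ (q i) (q j) = 0)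
    (hq1 : ∀ i, q i = 0 ∨ ‖q i‖ = 1) (j : Fin k) : projCompl q *ᵥ (q j).ofLp = 0 := by
  have h := toLp_projCompl_mulVec q (q j)
  rw [Finset.sum_eq_single j (fun i _ hij => by rw [hq i j hij, zero_smul]) (by simp),
    real_inner_self_eq_norm_sq] at h
  have h2 : q j - ‖q j‖ ^ 2 • q j = 0 := by
    rcases hq1 j with h0 | h0 <;> simp [h0]
  rw [h2] at h
  simpa using h

theorem projCompl_mul_self {q : Fin k → Vec n} (hq : ∀ i j, i ≠ j → inner ℝ (q i) (q j) = 0)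
    (hq1 : ∀ i, q i = 0 ∨ ‖q i‖ = 1) : projCompl q * projCompl q = projCompl q := by
  conv_lhs => rhs; rw [projCompl]
  rw [Matrix.mul_sub, Matrix.mul_one, Matrix.mul_sum, sub_eq_self]
  refine Finset.sum_eq_zero fun i _ => ?_
  rw [mul_vecMulVec, projCompl_mulVec_self hq hq1, zero_vecMulVec]

theorem trace_eq_sum_add_trace_projCompl {q : Fin k → Vec n}
    (hq : ∀ i j, i ≠ j → inner ℝ (q i) (q j) = 0) (hq1 : ∀ i, q i = 0 ∨ ‖q i‖ = 1)
    (A : Matrix (Fin n) (Fin n) ℝ) :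
    A.trace = ∑ i, inner ℝ (q i) (matVec A (q i)) + (projCompl q * A * projCompl q).trace := by
  rw [trace_mul_comm, ← Matrix.mul_assoc, projCompl_mul_self hq hq1, projCompl, Matrix.sub_mul,
    Matrix.one_mul, trace_sub, Matrix.sum_mul, trace_sum]
  have : ∀ i, (vecMulVec (q i).ofLp (q i).ofLp * A).trace = inner ℝ (q i) (matVec A (q i)) := by
    intro i
    rw [vecMulVec_mul, trace_vecMulVec, dotProduct_comm, ← dotProduct_mulVec,
      EuclideanSpace.inner_eq_star_dotProduct, dotProduct_comm]
    rfl
  simp only [this]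
  ring

theorem gramSchmidtNormed_inner_eq_zero (f : Fin k → Vec n) (i j : Fin k) (hij : i ≠ j) :
    inner ℝ (InnerProductSpace.gramSchmidtNormed ℝ f i)
      (InnerProductSpace.gramSchmidtNormed ℝ f j) = 0 := by
  simp [InnerProductSpace.gramSchmidtNormed, inner_smul_left, inner_smul_right,
    InnerProductSpace.gramSchmidt_orthogonal ℝ f hij]

theorem gramSchmidtNormed_eq_zero_or_norm_eq_one (f : Fin k → Vec n) (i : Fin k) :
    InnerProductSpace.gramSchmidtNormed ℝ f i = 0 ∨
      ‖InnerProductSpace.gramSchmidtNormed ℝ f i‖ = 1 :=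
  or_iff_not_imp_left.mpr fun h => InnerProductSpace.gramSchmidtNormed_unit_length' h

/-- The kernel contains every Gram–Schmidt vector, hence their span, which is the span of `f`. -/
theorem projCompl_gramSchmidtNormed_mulVec (f : Fin k → Vec n) (j : Fin k) :
    projCompl (InnerProductSpace.gramSchmidtNormed ℝ f) *ᵥ (f j).ofLp = 0 := by
  set q := InnerProductSpace.gramSchmidtNormed ℝ f with hq
  have hmem : f j ∈ LinearMap.ker (toEuclideanLin (projCompl q)) := by
    have h1 : f j ∈ Submodule.span ℝ (Set.range f) := Submodule.subset_span ⟨j, rfl⟩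
    rw [← InnerProductSpace.span_gramSchmidt ℝ f,
      ← InnerProductSpace.span_gramSchmidtNormed_range] at h1
    refine Submodule.span_le.mpr ?_ h1
    rintro _ ⟨i, rfl⟩
    have := projCompl_mulVec_self (gramSchmidtNormed_inner_eq_zero f)
      (gramSchmidtNormed_eq_zero_or_norm_eq_one f) i
    rw [SetLike.mem_coe, LinearMap.mem_ker, toLpLin_apply]
    exact congrArg (WithLp.toLp 2) this
  exact congrArg WithLp.ofLp (LinearMap.mem_ker.mp hmem)

end Projection

/-! ### Outputs and query counts of the algorithm -/

namespace MatVecAlg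

variable {n : ℕ} {α β : Type} (A : Matrix (Fin n) (Fin n) ℝ)

theorem run_andThen (a : MatVecAlg n α) (f : α → MatVecAlg n β) :
    (a.andThen f).run A = (f (a.run A)).run A := by
  induction a with
  | output a => rfl
  | query v next ih => exact ih _

theorem numQueries_andThen (a : MatVecAlg n α) (f : α → MatVecAlg n β) :
    (a.andThen f).numQueries A = a.numQueries A + (f (a.run A)).numQueries A := by
  induction a with
  | output a => exact (Nat.zero_add _).symm
  | query v next ih =>
    change ((next _).andThen f).numQueries A + 1 = (next _).numQueries A + 1 + _
    rw [ih]
    simp only [run]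
    ring

theorem run_queryAll {k : ℕ} (v : Fin k → Vec n) :
    (queryAll v).run A = fun i => matVec A (v i) := by
  induction k with
  | zero => funext i; exact i.elim0
  | succ k ih =>
    rw [queryAll, run, run_andThen, ih, run]
    funext i
    refine Fin.cases ?_ (fun j => ?_) i <;> simp

theorem numQueries_queryAll {k : ℕ} (v : Fin k → Vec n) : (queryAll v).numQueries A = k := by
  induction k with
  | zero => rfl
  | succ k ih => rw [queryAll, numQueries, numQueries_andThen, ih, numQueries, add_zero]

end MatVecAlg

theorem numQueries_hutchPP {n k : ℕ} (S G : Fin k → Vec n) (A : Matrix (Fin n) (Fin n) ℝ) :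
    (hutchPP S G).numQueries A = 3 * k := by
  simp only [hutchPP, MatVecAlg.numQueries_andThen, MatVecAlg.numQueries_queryAll,
    MatVecAlg.numQueries]
  ring

/-- The error of Hutch++ is the error of the Rademacher estimator of the trace of `P A P`. -/
theorem trace_sub_run_hutchPP {n k : ℕ} (hk : 0 < k) (S : Fin k → Vec n) (g : SignMatrix n k)
    (A : Matrix (Fin n) (Fin n) ℝ) :
    A.trace - (hutchPP S g.col).run A = -(1 / (k : ℝ) * traceDev
      (projCompl (InnerProductSpace.gramSchmidtNormed ℝ fun i => matVec A (S i)) * A *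
        projCompl (InnerProductSpace.gramSchmidtNormed ℝ fun i => matVec A (S i))) g) := by
  simp only [hutchPP, MatVecAlg.run_andThen, MatVecAlg.run_queryAll, MatVecAlg.run]
  set q := InnerProductSpace.gramSchmidtNormed ℝ fun i => matVec A (S i) with hq
  set P := projCompl q with hP
  have htr := trace_eq_sum_add_trace_projCompl (gramSchmidtNormed_inner_eq_zero _)
    (gramSchmidtNormed_eq_zero_or_norm_eq_one fun i => matVec A (S i)) A
  rw [← hq, ← hP] at htr
  have hH : ∀ j, inner ℝ (g.col j - ∑ i, inner ℝ (q i) (g.col j) • q i)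
      (matVec A (g.col j - ∑ i, inner ℝ (q i) (g.col j) • q i)) =
      signVec (g j) ⬝ᵥ (P * A * P) *ᵥ signVec (g j) := fun j => by
    rw [← toLp_projCompl_mulVec, ← hP, EuclideanSpace.inner_eq_star_dotProduct, dotProduct_comm]
    change (P *ᵥ signVec (g j)) ⬝ᵥ A *ᵥ (P *ᵥ signVec (g j)) = _
    rw [← mulVec_mulVec, ← mulVec_mulVec, dotProduct_mulVec (signVec (g j)) P, ← mulVec_transpose,
      (projCompl_isSymm q).eq]
  have hk' : (k : ℝ) ≠ 0 := by positivity
  simp only [hH, traceDev, Finset.sum_sub_distrib, Finset.sum_const, Finset.card_univ,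
    Fintype.card_fin, nsmul_eq_mul]
  rw [htr]
  field_simp
  ring

/-! ### Low-rank approximation and singular value tails -/

/-- The orthogonal projection onto the span of the top `r` right singular vectors leaves a residual
whose squared Frobenius norm is the tail sum of the squared singular values. -/
theorem exists_projection_frobSq_residual {n : ℕ} (A : Matrix (Fin n) (Fin n) ℝ) (r : ℕ) :
    ∃ (W : Submodule ℝ (Vec n)) (R : Matrix (Fin n) (Fin n) ℝ), Module.finrank ℝ W ≤ r ∧
      R.IsSymm ∧ R * R = R ∧ (∀ x, WithLp.toLp 2 (R *ᵥ x) ∈ W) ∧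
      frobSq (A * (1 - R)) =
        ∑ i : Fin n, if (i : ℕ) < r then 0 else (toEuclideanLin A).singularValues i ^ 2 := by
  classical
  set T := toEuclideanLin A with hT
  have hn : Module.finrank ℝ (Vec n) = n := by simp
  set v := T.isSymmetric_adjoint_comp_self.eigenvectorBasis hn with hv
  let V : Matrix (Fin n) (Fin n) ℝ := Matrix.of fun i j => (v j).ofLp i
  let d : Fin n → ℝ := fun i => if (i : ℕ) < r then 1 else 0
  have hVV : Vᵀ * V = 1 := by
    ext i j
    have h := orthonormal_iff_ite.mp v.orthonormal i j
    rw [EuclideanSpace.inner_eq_star_dotProduct, dotProduct_comm] at h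
    rw [one_apply, ← h]
    rfl
  have hVV' : V * Vᵀ = 1 := mul_eq_one_comm.mp hVV
  have hres : 1 - V * diagonal d * Vᵀ = V * diagonal (fun i => 1 - d i) * Vᵀ := by
    have : diagonal (fun i => 1 - d i) = 1 - diagonal d := by
      rw [← diagonal_one, diagonal_sub]
    rw [this, Matrix.mul_sub, Matrix.sub_mul, Matrix.mul_one, hVV']
  refine ⟨Submodule.span ℝ ((Finset.univ.filter fun i : Fin n => (i : ℕ) < r).image v),
    V * diagonal d * Vᵀ, ?_, ?_, ?_, ?_, ?_⟩
  · refine (finrank_span_finset_le_card _).trans (Finset.card_image_le.trans ?_)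
    calc (Finset.univ.filter fun i : Fin n => (i : ℕ) < r).card
        = ((Finset.univ.filter fun i : Fin n => (i : ℕ) < r).image Fin.val).card :=
          (Finset.card_image_of_injective _ Fin.val_injective).symm
      _ ≤ (Finset.range r).card := Finset.card_le_card fun i hi => by
          obtain ⟨j, hj, rfl⟩ := Finset.mem_image.mp hi
          exact Finset.mem_range.mpr (Finset.mem_filter.mp hj).2
      _ = r := Finset.card_range r
  · simp [Matrix.IsSymm, transpose_mul, Matrix.mul_assoc]
  · rw [show V * diagonal d * Vᵀ * (V * diagonal d * Vᵀ) =
      V * diagonal d * (Vᵀ * V) * diagonal d * Vᵀ by simp only [Matrix.mul_assoc], hVV,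
      Matrix.mul_one, Matrix.mul_assoc V, diagonal_mul_diagonal]
    congr 3
    ext i
    simp [d]
  · intro x
    have h : WithLp.toLp 2 ((V * diagonal d * Vᵀ) *ᵥ x) = ∑ i, (d i * (Vᵀ *ᵥ x) i) • v i := by
      apply WithLp.ofLp_injective 2
      funext l
      rw [← mulVec_mulVec, ← mulVec_mulVec]
      simp only [mulVec, dotProduct, V]
      simp [mul_comm, diagonal_apply]
    rw [h]
    refine Submodule.sum_mem _ fun i _ => ?_
    by_cases hi : (i : ℕ) < r
    · refine Submodule.smul_mem _ _ (Submodule.subset_span ?_)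
      simpa using ⟨i, hi, rfl⟩
    · simp [d, hi]
  · rw [hres]
    have h1 : frobSq (A * (V * diagonal (fun i => 1 - d i) * Vᵀ)) =
        frobSq (A * V * diagonal fun i => 1 - d i) := by
      rw [frobSq_eq_trace, frobSq_eq_trace, ← Matrix.mul_assoc, ← Matrix.mul_assoc,
        transpose_mul _ Vᵀ, transpose_transpose, Matrix.mul_assoc _ Vᵀ, ← Matrix.mul_assoc Vᵀ, hVV,
        Matrix.one_mul]
    -- Column j of AV is A v_j, and ‖A v_j‖² is the j-th eigenvalue of AᵀA.
    have h2 : ∀ j, ∑ i, (A * V) i j ^ 2 = T.singularValues j ^ 2 := by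
      intro j
      have h3 : ∑ i, (A * V) i j ^ 2 = ‖T (v j)‖ ^ 2 := by
        rw [EuclideanSpace.real_norm_sq_eq]
        rfl
      rw [h3, T.sq_singularValues_fin hn, ← real_inner_self_eq_norm_sq,
        ← LinearMap.adjoint_inner_right, ← LinearMap.comp_apply,
        LinearMap.IsSymmetric.apply_eigenvectorBasis, inner_smul_right,
        real_inner_self_eq_norm_sq]
      simp
    rw [h1, ← frobSq_transpose]
    refine Finset.sum_congr rfl fun j _ => ?_
    rw [← h2]
    simp only [transpose_apply, mul_diagonal, d]
    split_ifs <;> simp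

/-- The tail of the squares of an antitone sequence is controlled by its `p`-th power sum. -/
theorem sum_sq_tail_le_rpow {σ : ℕ → ℝ} (h0 : ∀ i, 0 ≤ σ i) (hanti : Antitone σ) {p : ℝ}
    (hp1 : 1 ≤ p) (hp2 : p ≤ 2) {r : ℕ} (hr : 0 < r) (n : ℕ) :
    (∑ i : Fin n, if (i : ℕ) < r then 0 else σ i ^ 2) ≤
      ((r : ℝ) ^ (1 / 2 - 1 / p) * (∑ i ∈ Finset.range n, σ i ^ p) ^ (1 / p)) ^ 2 := by
  have hp0 : 0 < p := by linarith
  have hr0 : (0 : ℝ) < r := Nat.cast_pos.mpr hr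
  set t := ∑ i ∈ Finset.range n, σ i ^ p with ht
  have ht0 : 0 ≤ t := Finset.sum_nonneg fun i _ => rpow_nonneg (h0 i) p
  rcases le_or_gt n r with hnr | hnr
  · rw [Finset.sum_eq_zero fun i _ => if_pos (i.2.trans_le hnr)]
    positivity
  -- Indices start at 0, so the r terms before `σ r` are all at least as large; they lie in the sum
  -- because r < n.
  have hσ : σ r ≤ (t / r) ^ (1 / p) := by
    rw [one_div, Real.le_rpow_inv_iff_of_pos (h0 r) (by positivity) hp0, le_div_iff₀ hr0]
    calc σ r ^ p * r = ∑ i ∈ Finset.range r, σ r ^ p := by simp [mul_comm]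
      _ ≤ ∑ i ∈ Finset.range r, σ i ^ p := Finset.sum_le_sum fun i hi =>
          rpow_le_rpow (h0 r) (hanti (Finset.mem_range.mp hi).le) hp0.le
      _ ≤ t := Finset.sum_le_sum_of_subset_of_nonneg
          (Finset.range_subset_range.mpr hnr.le) fun i _ _ => rpow_nonneg (h0 i) p
  have hterm : ∀ i, r ≤ i → σ i ^ 2 ≤ σ r ^ (2 - p) * σ i ^ p := fun i hi => by
    rcases (h0 i).eq_or_lt with h | h
    · rw [← h]; simp [zero_rpow hp0.ne']
    · rw [← rpow_natCast, show ((2 : ℕ) : ℝ) = (2 - p) + p by push_cast; ring, rpow_add h]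
      exact mul_le_mul_of_nonneg_right (rpow_le_rpow (h0 i) (hanti hi) (by linarith))
        (rpow_nonneg (h0 i) p)
  calc (∑ i : Fin n, if (i : ℕ) < r then 0 else σ i ^ 2)
      ≤ ∑ i : Fin n, σ r ^ (2 - p) * σ i ^ p := Finset.sum_le_sum fun i _ => by
        split_ifs with h
        · exact mul_nonneg (rpow_nonneg (h0 r) _) (rpow_nonneg (h0 i) p)
        · exact hterm i (not_lt.mp h)
    _ = σ r ^ (2 - p) * t := by
        rw [← Finset.mul_sum, ht, Finset.sum_range]
    _ ≤ ((t / r) ^ (1 / p)) ^ (2 - p) * t := by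
        refine mul_le_mul_of_nonneg_right (rpow_le_rpow (h0 r) hσ (by linarith)) ht0
    _ = ((r : ℝ) ^ (1 / 2 - 1 / p) * t ^ (1 / p)) ^ 2 := by
        rcases ht0.eq_or_lt with h | h
        · rw [← h]; simp [zero_rpow (inv_ne_zero hp0.ne')]
        · have e1 : ((t / r) ^ (1 / p)) ^ (2 - p) = t ^ (2 / p - 1) * (r : ℝ) ^ (1 - 2 / p) := by
            rw [← rpow_mul (by positivity), div_rpow h.le hr0.le, div_eq_mul_inv,
              ← rpow_neg hr0.le]
            congr 2 <;> field_simp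
            ring
          have e2 : ((r : ℝ) ^ (1 / 2 - 1 / p)) ^ 2 = (r : ℝ) ^ (1 - 2 / p) := by
            rw [← rpow_mul_natCast hr0.le]
            congr 1
            push_cast; ring
          have e3 : (t ^ (1 / p)) ^ 2 = t ^ (2 / p - 1) * t := by
            rw [← rpow_mul_natCast h.le, ← rpow_add_one h.ne']
            congr 1
            push_cast; ring
          rw [e1, mul_pow, e2, e3]
          ring

/-! ### Failure probabilities and the choice of parameters -/

/-- With a sketch of `5120 r` columns, the Hutch++ projection captures `A` up to a constant
multiple of its best rank-`r` approximation error, except with probability `4 exp (-r)`. -/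
theorem exists_bad_sketch {n : ℕ} (A : Matrix (Fin n) (Fin n) ℝ) {p : ℝ} (hp1 : 1 ≤ p)
    (hp2 : p ≤ 2) {r k : ℕ} (hr : 0 < r) (hk : k = 5120 * r) :
    ∃ bad : Finset (SignMatrix n k),
      (bad.card : ℝ) ≤ 4 * exp (-r) * Fintype.card (SignMatrix n k) ∧
      ∀ s ∉ bad, ∀ P : Matrix (Fin n) (Fin n) ℝ, P.IsSymm → P * P = P →
        (∀ j, P *ᵥ (A *ᵥ signVec (s j)) = 0) →
        frobSq (P * A * P) ≤ 5 * ((r : ℝ) ^ (1 / 2 - 1 / p) * schattenNorm p A) ^ 2 := by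
  classical
  obtain ⟨W, R, hW, hR, hRi, hRW, hres⟩ := exists_projection_frobSq_residual A r
  obtain ⟨bad, hbad, hlow⟩ := card_not_le_sum_sq_inner_col_le k W hW
  have hkr : (k : ℝ) = 5120 * r := by rw [hk]; push_cast; ring
  have hr0 : (0 : ℝ) < r := Nat.cast_pos.mpr hr
  have hk0 : (0 : ℝ) < k := by rw [hkr]; positivity
  have hF : frobSq (A * (1 - R)) ≤ ((r : ℝ) ^ (1 / 2 - 1 / p) * schattenNorm p A) ^ 2 := by
    rw [hres]
    exact sum_sq_tail_le_rpow (LinearMap.singularValues_nonneg _)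
      (LinearMap.singularValues_antitone _) hp1 hp2 hr n
  set M := A * (1 - R) with hM
  refine ⟨bad ∪ Finset.univ.filter fun s : SignMatrix n k =>
    2 * k * frobSq M < ∑ j, M *ᵥ signVec (s j) ⬝ᵥ M *ᵥ signVec (s j), ?_, ?_⟩
  · have h1 := card_two_mul_frobSq_lt_sum_le k M
    have h2 : ((bad ∪ Finset.univ.filter fun s : SignMatrix n k =>
        2 * k * frobSq M < ∑ j, M *ᵥ signVec (s j) ⬝ᵥ M *ᵥ signVec (s j)).card : ℝ) ≤ _ :=
      Nat.cast_le.mpr (Finset.card_union_le _ _)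
    push_cast at h2
    -- 5120 = 5 · 1024: the tail is exp(-5r), and the 25^r ≤ exp(4r) pairs of net points leave
    -- exp(-r).
    have h3 : (25 : ℝ) ^ r * (2 * exp (-(k / 1024))) ≤ 2 * exp (-r) := by
      have h25 : (25 : ℝ) ≤ exp 4 := by
        have : (2.7 : ℝ) ^ 4 ≤ exp 1 ^ 4 :=
          pow_le_pow_left₀ (by norm_num) (by linarith [exp_one_gt_d9]) 4
        rw [← exp_nat_mul] at this
        norm_num at this
        linarith
      calc (25 : ℝ) ^ r * (2 * exp (-(k / 1024))) ≤ exp 4 ^ r * (2 * exp (-(k / 1024))) := by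
            gcongr
        _ = 2 * exp (-r) := by
            rw [← exp_nat_mul, mul_left_comm, ← exp_add, hkr]
            ring_nf
    have h4 : exp (-((k : ℝ) / 16)) ≤ exp (-r) := by
      rw [hkr, exp_le_exp]; linarith
    have hc : (0 : ℝ) ≤ Fintype.card (SignMatrix n k) := Nat.cast_nonneg _
    have h5 := mul_le_mul_of_nonneg_right h3 hc
    have h6 := mul_le_mul_of_nonneg_right h4 hc
    linarith
  · intro s hs P hP hPi hPs
    rw [Finset.mem_union, not_or] at hs
    have hs2 : ∑ j, M *ᵥ signVec (s j) ⬝ᵥ M *ᵥ signVec (s j) ≤ 2 * k * frobSq M := by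
      by_contra! h
      exact hs.2 (Finset.mem_filter.mpr ⟨Finset.mem_univ _, h⟩)
    have h := frobSq_mul_le_of_annihilates hP hPi hR hRi (fun j => signVec (s j)) hPs
      (half_pos hk0) fun x => by
        have := hlow s hs.1 _ (hRW x)
        simp only [inner_col, ← ofLp_dotProduct_self] at this
        exact this
    -- With c = k/2, the sketched energy 2k‖M‖_F² contributes 4 and the residual itself 1.
    have h2 : frobSq (P * A) ≤ 5 * frobSq M := by
      refine le_of_mul_le_mul_left ?_ (half_pos hk0)
      linarith
    linarith [frobSq_mul_right_le hP hPi (P * A)]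

/-- A union bound by slices: the second bad set may depend on the first coordinate. This is where
the independence of S and G enters. -/
theorem exists_finset_prod_card_le {α β : Type*} [Fintype α] [Fintype β] (E : Finset α)
    (D : α → Finset β) {a b : ℝ} (hb : 0 ≤ b) (hE : (E.card : ℝ) ≤ a * Fintype.card α)
    (hD : ∀ s ∉ E, ((D s).card : ℝ) ≤ b * Fintype.card β) :
    ∃ bad : Finset (α × β), (bad.card : ℝ) ≤ (a + b) * Fintype.card (α × β) ∧
      ∀ ω ∉ bad, ω.1 ∉ E ∧ ω.2 ∉ D ω.1 := by
  classical
  refine ⟨E ×ˢ Finset.univ ∪ Eᶜ.biUnion fun s => {s} ×ˢ D s, ?_, fun ω hω => ?_⟩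
  · have h1 := (Finset.card_union_le (E ×ˢ (Finset.univ : Finset β))
      (Eᶜ.biUnion fun s => {s} ×ˢ D s)).trans (Nat.add_le_add_left Finset.card_biUnion_le _)
    have h2 : ((E ×ˢ (Finset.univ : Finset β) ∪
      Eᶜ.biUnion fun s => {s} ×ˢ D s).card : ℝ) ≤ _ := Nat.cast_le.mpr h1
    simp only [Finset.card_product, Finset.card_singleton, one_mul, Finset.card_univ] at h2
    push_cast at h2
    have h3 : ∑ s ∈ Eᶜ, ((D s).card : ℝ) ≤ ∑ _s : α, b * Fintype.card β :=
      (Finset.sum_le_sum fun s hs => hD s (Finset.mem_compl.mp hs)).trans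
        (Finset.sum_le_sum_of_subset_of_nonneg (Finset.subset_univ _)
          fun _ _ _ => by positivity)
    rw [Finset.sum_const, Finset.card_univ, nsmul_eq_mul] at h3
    have h4 := mul_le_mul_of_nonneg_right hE (Nat.cast_nonneg (α := ℝ) (Fintype.card β))
    rw [Fintype.card_prod]
    push_cast
    linarith
  · simp only [Finset.mem_union, Finset.mem_product, Finset.mem_univ, and_true,
      Finset.mem_biUnion, Finset.mem_compl, Finset.mem_singleton, not_or, not_exists,
      not_and] at hω
    exact ⟨hω.1, fun h => hω.2 _ hω.1 rfl h⟩

/-- Except with probability `6 exp (-l)`, the error of Hutch++ with `5120 r` columns is at most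
`√l * r ^ (-1 / p)` times the Schatten norm. -/
theorem exists_bad_hutchPPRandom {n : ℕ} (A : Matrix (Fin n) (Fin n) ℝ) {p : ℝ} (hp1 : 1 ≤ p)
    (hp2 : p ≤ 2) {r k : ℕ} (hr : 0 < r) (hk : k = 5120 * r) {l : ℝ} (hl : 0 ≤ l) (hlr : l ≤ r) :
    ∃ bad : Finset (SignMatrix n k × SignMatrix n k),
      (bad.card : ℝ) ≤ 6 * exp (-l) * Fintype.card (SignMatrix n k × SignMatrix n k) ∧
      ∀ ω ∉ bad, |A.trace - (hutchPPRandom n k ω).run A| ≤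
        √l * (r : ℝ) ^ (-(1 / p)) * schattenNorm p A := by
  classical
  obtain ⟨bad, hbad, hgood⟩ := exists_bad_sketch A hp1 hp2 hr hk
  have hkr : (k : ℝ) = 5120 * r := by rw [hk]; push_cast; ring
  have hr0 : (0 : ℝ) < r := Nat.cast_pos.mpr hr
  have hk0 : (0 : ℝ) < k := by rw [hkr]; positivity
  have hN : 0 ≤ schattenNorm p A := by
    refine rpow_nonneg (Finset.sum_nonneg fun i _ => rpow_nonneg ?_ _) _
    exact LinearMap.singularValues_nonneg _ _
  set F := √5 * ((r : ℝ) ^ (1 / 2 - 1 / p) * schattenNorm p A) with hFdef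
  have hF0 : 0 ≤ F := by positivity
  let P : SignMatrix n k → Matrix (Fin n) (Fin n) ℝ := fun s =>
    projCompl (InnerProductSpace.gramSchmidtNormed ℝ fun i => matVec A (s.col i))
  -- With a = τ/8 the tail exponent is exactly l; l ≤ r keeps a ≤ 1/4.
  let τ : ℝ := 4 * √(l / k)
  let badG : SignMatrix n k → Finset (SignMatrix n k) := fun s =>
    Finset.univ.filter fun g => k * (τ * F) < |traceDev (P s * A * P s) g|
  have hF : ∀ s ∉ bad, frobSq (P s * A * P s) ≤ F ^ 2 := fun s hs => by
    rw [hFdef, mul_pow, sq_sqrt (by norm_num)]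
    refine hgood s hs (P s) (projCompl_isSymm _) (projCompl_mul_self
      (gramSchmidtNormed_inner_eq_zero _) (gramSchmidtNormed_eq_zero_or_norm_eq_one _)) fun j => ?_
    exact projCompl_gramSchmidtNormed_mulVec (fun i => matVec A (s.col i)) j
  have hbG : ∀ s ∉ bad, ((badG s).card : ℝ) ≤
      2 * exp (-l) * Fintype.card (SignMatrix n k) := fun s hs => by
    have ha4 : √(l / k) / 2 ≤ 1 / 4 := by
      have : √(l / k) ≤ 1 / 2 := by
        rw [sqrt_le_left (by norm_num), div_le_iff₀ hk0, hkr]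
        linarith
      linarith
    have h := card_abs_traceDev_gt_le (a := √(l / k) / 2) (τ := τ) k _ hF0 (hF s hs)
      (by positivity) ha4
    have e : (k : ℝ) * (√(l / k) / 2 * τ - 4 * (√(l / k) / 2) ^ 2) = l := by
      have : √(l / k) ^ 2 = l / k := sq_sqrt (by positivity)
      calc _ = (k : ℝ) * √(l / k) ^ 2 := by simp only [τ]; ring
        _ = l := by rw [this]; field_simp
    rw [e] at h
    exact h
  have hel : exp (-(r : ℝ)) ≤ exp (-l) := exp_le_exp.mpr (neg_le_neg hlr)
  obtain ⟨bad₂, hbad₂, hgood₂⟩ := exists_finset_prod_card_le bad badG (by positivity) hbad hbG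
  refine ⟨bad₂, hbad₂.trans ?_, fun ω hω => ?_⟩
  · refine mul_le_mul_of_nonneg_right ?_ (Nat.cast_nonneg _)
    linarith
  · have hdev : |traceDev (P ω.1 * A * P ω.1) ω.2| ≤ k * (τ * F) := by
      by_contra! h
      exact (hgood₂ ω hω).2 (Finset.mem_filter.mpr ⟨Finset.mem_univ _, h⟩)
    rw [hutchPPRandom, trace_sub_run_hutchPP (Nat.cast_pos.mp hk0), abs_neg, abs_mul,
      abs_of_nonneg (by positivity)]
    have hτ : τ * √5 ≤ √l * (r : ℝ) ^ (-(1 / 2) : ℝ) := by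
      have e1 : (r : ℝ) ^ (-(1 / 2) : ℝ) = √(r : ℝ)⁻¹ := by
        rw [sqrt_eq_rpow, inv_rpow hr0.le, rpow_neg hr0.le]
      rw [e1, ← sqrt_mul hl]
      refine le_sqrt_of_sq_le ?_
      have e2 : √(l / k) ^ 2 = l / k := sq_sqrt (by positivity)
      have e3 : (√5 : ℝ) ^ 2 = 5 := sq_sqrt (by norm_num)
      calc (τ * √5) ^ 2 = 16 * √(l / k) ^ 2 * √5 ^ 2 := by simp only [τ]; ring
        _ = 1 / 64 * (l * (r : ℝ)⁻¹) := by rw [e2, e3, hkr]; field_simp; ring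
        _ ≤ l * (r : ℝ)⁻¹ := by
          have : 0 ≤ l * (r : ℝ)⁻¹ := by positivity
          linarith
    calc 1 / (k : ℝ) * |traceDev (P ω.1 * A * P ω.1) ω.2|
        ≤ 1 / (k : ℝ) * (k * (τ * F)) := by gcongr
      _ = (τ * √5) * ((r : ℝ) ^ (1 / 2 - 1 / p) * schattenNorm p A) := by
          rw [hFdef]; field_simp
      _ ≤ (√l * (r : ℝ) ^ (-(1 / 2) : ℝ)) *
          ((r : ℝ) ^ (1 / 2 - 1 / p) * schattenNorm p A) := by gcongr
      _ = √l * ((r : ℝ) ^ (-(1 / 2) : ℝ) * (r : ℝ) ^ (1 / 2 - 1 / p)) * schattenNorm p A := by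
          ring
      _ = √l * (r : ℝ) ^ (-(1 / p)) * schattenNorm p A := by
          rw [← rpow_add hr0]
          congr 3
          ring

theorem ofReal_one_sub_le_toOuterMeasure_uniformOfFintype {α : Type} [Fintype α] [Nonempty α]
    {δ : ℝ} {bad : Finset α} (hbad : (bad.card : ℝ) ≤ δ * Fintype.card α) {s : Set α}
    (hs : ∀ x ∉ bad, x ∈ s) :
    ENNReal.ofReal (1 - δ) ≤ (PMF.uniformOfFintype α).toOuterMeasure s := by
  classical
  rw [PMF.toOuterMeasure_uniformOfFintype_apply]
  have hα : (0 : ℝ) < Fintype.card α := Nat.cast_pos.mpr Fintype.card_pos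
  have h1 : Fintype.card α ≤ bad.card + Fintype.card s := by
    rw [← Set.toFinset_card s, ← Finset.card_univ]
    refine (Finset.card_le_card fun x _ => ?_).trans (Finset.card_union_le bad s.toFinset)
    by_cases h : x ∈ bad
    · exact Finset.mem_union_left _ h
    · exact Finset.mem_union_right _ (Set.mem_toFinset.mpr (hs x h))
  have h2 : (Fintype.card α : ℝ) ≤ bad.card + Fintype.card s := by exact_mod_cast h1
  have h3 : 1 - δ ≤ (Fintype.card s : ℝ) / Fintype.card α := by
    rw [le_div_iff₀ hα]; linarith
  refine (ENNReal.ofReal_le_ofReal h3).trans ?_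
  rw [ENNReal.ofReal_div_of_pos hα, ENNReal.ofReal_natCast, ENNReal.ofReal_natCast]

theorem mainTheorem5 (δ₀ : ℝ) (hδ₀ : δ₀ < 1) :
    ∃ C : ℝ, 0 < C ∧
      ∀ p : ℝ, 1 ≤ p → p ≤ 2 → ∀ ε : ℝ, 0 < ε → ∀ δ : ℝ, 0 < δ → δ ≤ δ₀ →
        ∃ k : ℕ, 0 < k ∧ ∀ (n : ℕ) (A : Matrix (Fin n) (Fin n) ℝ),
          (∀ ω : SignMatrix n k × SignMatrix n k,
            ((hutchPPRandom n k ω).numQueries A : ℝ) ≤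
              C * ((Real.sqrt (Real.log (1 / δ)) / ε) ^ p + Real.log (1 / δ))) ∧
          ENNReal.ofReal (1 - δ) ≤
            (rademacherPair n k).toOuterMeasure
              {ω | |A.trace - (hutchPPRandom n k ω).run A| ≤ ε * schattenNorm p A} := by
  rcases le_or_gt δ₀ 0 with h0 | h0
  · exact ⟨1, one_pos, fun p _ _ ε _ δ hδ hδ' => absurd (hδ.trans_le hδ') (not_lt.mpr h0)⟩
  have hlog₀ : 0 < log (1 / δ₀) := log_pos (by rw [lt_div_iff₀ h0]; linarith)
  have hlog6 : 1 ≤ log 6 := by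
    rw [le_log_iff_exp_le (by norm_num)]
    linarith [exp_one_lt_d9]
  -- This absorbs the failure factor 6: log(6/δ) ≤ C₀ log(1/δ), because log(1/δ) is at least
  -- log(1/δ₀) > 0.
  set C₀ := 1 + log 6 / log (1 / δ₀) with hC₀
  have hC₀1 : 1 ≤ C₀ := le_add_of_nonneg_right (by positivity)
  -- 30720 = 2 · 3 · 5120: three rounds of 5120 r queries, and a factor 2 because l ≥ 1 absorbs the
  -- rounding in `r`.
  refine ⟨30720 * C₀, by positivity, fun p hp1 hp2 ε hε δ hδ hδ' => ?_⟩
  have hp0 : 0 < p := by linarith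
  set L := log (1 / δ) with hL
  have hL0 : log (1 / δ₀) ≤ L := log_le_log (by positivity) (by gcongr)
  have hLpos : 0 < L := hlog₀.trans_le hL0
  set l := log 6 + L with hl
  have hlC : l ≤ C₀ * L := by
    have : log 6 ≤ log 6 / log (1 / δ₀) * L := by
      rw [div_mul_eq_mul_div, le_div_iff₀ hlog₀]
      gcongr
    rw [hC₀, add_mul, one_mul]
    linarith
  have hl1 : 1 ≤ l := by linarith
  have hX0 : 0 ≤ (√l / ε) ^ p := by positivity
  -- The first summand gives l ≤ r, the second √l r^(-1/p) ≤ ε.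
  set r := ⌈l + (√l / ε) ^ p⌉₊ with hr
  have hr1 : l + (√l / ε) ^ p ≤ r := Nat.le_ceil _
  have hr2 : (r : ℝ) < l + (√l / ε) ^ p + 1 := Nat.ceil_lt_add_one (by positivity)
  have hr0 : (0 : ℝ) < r := by linarith
  refine ⟨5120 * r, by have := Nat.cast_pos.mp hr0; omega, fun n A => ⟨fun ω => ?_, ?_⟩⟩
  · rw [hutchPPRandom, numQueries_hutchPP]
    have hX : (√l / ε) ^ p ≤ C₀ * (√L / ε) ^ p := by
      calc (√l / ε) ^ p ≤ (√C₀ * (√L / ε)) ^ p := by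
            rw [← mul_div_assoc, ← sqrt_mul (by positivity)]
            gcongr
        _ = √C₀ ^ p * (√L / ε) ^ p := mul_rpow (by positivity) (by positivity)
        _ ≤ √C₀ ^ (2 : ℝ) * (√L / ε) ^ p := by
            gcongr
            exact one_le_sqrt.mpr hC₀1
        _ = C₀ * (√L / ε) ^ p := by
            rw [rpow_two, sq_sqrt (by positivity)]
    have hY0 : 0 ≤ C₀ * (√L / ε) ^ p := by positivity
    push_cast
    linarith
  · obtain ⟨bad, hbad, hgood⟩ := exists_bad_hutchPPRandom A hp1 hp2 (Nat.cast_pos.mp hr0) rfl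
      (by linarith : 0 ≤ l) (by linarith)
    have hδe : 6 * exp (-l) = δ := by
      rw [hl, hL, one_div, log_inv, neg_add, neg_neg, exp_add, exp_neg, exp_log (by norm_num),
        exp_log hδ]
      ring
    rw [hδe] at hbad
    refine ofReal_one_sub_le_toOuterMeasure_uniformOfFintype hbad fun ω hω => ?_
    refine (hgood ω hω).trans ?_
    have hN : 0 ≤ schattenNorm p A := by
      refine rpow_nonneg (Finset.sum_nonneg fun i _ => rpow_nonneg ?_ _) _
      exact LinearMap.singularValues_nonneg _ _
    refine mul_le_mul_of_nonneg_right ?_ hN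
    have h1 : √l / ε ≤ (r : ℝ) ^ (1 / p) := by
      rw [one_div, Real.le_rpow_inv_iff_of_pos (by positivity) hr0.le hp0]
      linarith
    rw [rpow_neg hr0.le, ← div_eq_mul_inv, div_le_iff₀ (by positivity)]
    rw [div_le_iff₀ hε] at h1
    linarith
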